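/- Let $0<w<b$ and $u>0$ be real numbers, and let $(N_t)_{t\ge0}$ and $(M^d_t)_{t\ge0}$ be independent Poisson processes with intensities $\lambda>0$ and $\mu_d>0$. Consider the surplus $R_t=u-w\,(N_t+M^d_t)+b\,N_t$, $t\ge 0$, of a mining-pool manager with deterministic rewards, and its ruin time $\tau=\inf\{t\ge0: R_t<0\}\in[0,\infty]$ (with $\inf\emptyset=\infty$). Let $S^d_k=\inf\{t\ge 0: M^d_t\ge k\}$ be the arrival times of $M^d$, and write $f_{S^d_k}$ for the probability density function of $S^d_k$, $k\ge1$. The Abel–Gontcharov polynomials $G_n(x\mid u_1,\dots,u_n)$ are defined by $G_0=1$ and, for $n\ge1$, $$\frac{d}{dx}G_n(x\mid u_1,\dots,u_n)=n\,G_{n-1}(x\mid u_2,\dots,u_n),\qquad G_n(u_1\mid u_1,\dots,u_n)=0 .$$ For a sequence $(v_n)_{n\ge0}$ of positive integers put $$f_v(t)=\sum_{n=0}^{\infty}\mathbb E\!\left[\frac{(-1)^n}{t^n}\,G_n\big(0\mid S^d_{v_0},\dots,S^d_{v_{n-1}}\big)\,\Big|\,S^d_{v_n}=t\right] f_{S^d_{v_n}}(t)\;\mathbb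 P(N_t=n),\qquad t>0 .$$ Then the following hold. 1. With $v_n=\lfloor n(b-w)/w+u/w\rfloor+1$, $f_v$ is the (possibly defective) density of $\tau$: $\mathbb P(\tau\in A)=\int_A f_v(t)\,dt$ for every Borel set $A\subseteq[0,\infty)$. 2. In particular, if none of the numbers $n(b-w)/w+u/w$, $n\ge0$, is an integer, then $\tau$ has density $f_v$ with $v_n=\lceil n(b-w)/w+u/w\rceil$. 3. Without any integrality condition, the first time $\tau_0=\inf\{t\ge0:R_t\le 0\}$ at which the surplus reaches $0$ or falls below it has density $f_v$, in the same sense, with $v_n=\lceil n(b-w)/w+u/w\rceil$. In each case $\tau$ (respectively $\tau_0$) is measurable, the arrival times $S^d_{v_n}$ have densities, and for almost every $t>0$ the conditional expectations are of integrable random variables and the series is a convergent series of nonnegative terms. -/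

import Mathlib

open MeasureTheory ProbabilityTheory Set Polynomial
open scoped NNReal ENNReal

noncomputable section

namespace PoolRuin

/-- The polynomial antiderivative of `p` that vanishes at `0`. -/
def antideriv (p : ℝ[X]) : ℝ[X] :=
  p.sum fun k a => monomial (k + 1) (a / (k + 1 : ℝ))

theorem derivative_antideriv (p : ℝ[X]) : derivative (antideriv p) = p := by
  unfold antideriv
  rw [Polynomial.sum_def, derivative_sum]
  conv_rhs => rw [p.as_sum_support]
  refine Finset.sum_congr rfl fun k _ => ?_
  rw [derivative_monomial]
  have hk : ((k : ℝ) + 1) ≠ 0 := by positivity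
  simp [div_mul_cancel₀ _ hk]

/-- The Abel–Gontcharov polynomials `G_n(· | u_1, …, u_n)`: `G_0 = 1`, and `G_{n+1}(· | U)` is the
antiderivative of `(n + 1) G_n(· | ℰU)` vanishing at the first node of `U`, where `ℰU` is `U`
with its first node removed. -/
def abelGontcharov : (n : ℕ) → (Fin n → ℝ) → ℝ[X]
  | 0, _ => 1
  | n + 1, U =>
    let q := antideriv (C (n + 1 : ℝ) * abelGontcharov n (Fin.tail U))
    q - C (q.eval (U 0))

theorem abelGontcharov_zero (U : Fin 0 → ℝ) : abelGontcharov 0 U = 1 := by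
  simp [abelGontcharov]

/-- The differential equation characterising the family. -/
theorem derivative_abelGontcharov (n : ℕ) (U : Fin (n + 1) → ℝ) :
    derivative (abelGontcharov (n + 1) U)
      = C (n + 1 : ℝ) * abelGontcharov n (Fin.tail U) := by
  simp only [abelGontcharov, derivative_sub, derivative_C, sub_zero, derivative_antideriv]

/-- The boundary condition characterising the family. -/
theorem abelGontcharov_eval_first (n : ℕ) (U : Fin (n + 1) → ℝ) :
    (abelGontcharov (n + 1) U).eval (U 0) = 0 := by
  simp [abelGontcharov]

variable {Ω : Type*} [MeasurableSpace Ω]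

/-- `N` is a homogeneous Poisson process of intensity `r` under `P`: a counting process (started at
`0`, with nondecreasing right-continuous `ℕ`-valued paths) with independent increments,
such that `N_t - N_s` has the Poisson law of mean `r (t - s)` for `s ≤ t`. (Paths are monotone,
so no difference of natural numbers is truncated.) -/
structure IsPoissonProcess (N : ℝ≥0 → Ω → ℕ) (r : ℝ≥0) (P : Measure Ω) : Prop where
  measurable : ∀ t, Measurable (N t)
  zero : ∀ ω, N 0 ω = 0
  mono : ∀ ω, Monotone fun t => N t ω
  rightCts : ∀ ω t, ContinuousWithinAt (fun s => N s ω) (Ici t) t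
  indepIncrements : HasIndepIncrements N P
  law_increment : ∀ s t, s ≤ t →
    HasLaw (fun ω => N t ω - N s ω) (poissonMeasure (r * (t - s))) P

/-- The `k`-th arrival time `S_k = inf {t ≥ 0 : M_t ≥ k}` of a counting process (`0` on
the event that `M` never reaches `k`, a null event for a Poisson process of positive intensity). -/
def arrivalTime (M : ℝ≥0 → Ω → ℕ) (k : ℕ) (ω : Ω) : ℝ :=
  ((sInf {t : ℝ≥0 | k ≤ M t ω} : ℝ≥0) : ℝ)

/-- The surplus `R_t = u - w M_t + b N_t` of the pool manager, where `M_t = N_t + Md_t` counts all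
shares: each block found (counted by `N`) is a share too, and `Md` counts the other shares. -/
def surplus (u w b : ℝ) (N Md : ℝ≥0 → Ω → ℕ) (t : ℝ≥0) (ω : Ω) : ℝ :=
  u - w * ((N t ω + Md t ω : ℕ) : ℝ) + b * (N t ω : ℝ)

/-- The ruin time `inf {t ≥ 0 : R_t < 0}`, equal to `∞` if there is no ruin. -/
def ruinTime (R : ℝ≥0 → Ω → ℝ) (ω : Ω) : ℝ≥0∞ :=
  ⨅ (t : ℝ≥0) (_ : R t ω < 0), (t : ℝ≥0∞)

/-- The time `inf {t ≥ 0 : R_t ≤ 0}` at which the surplus first reaches or passes `0`. -/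
def exhaustionTime (R : ℝ≥0 → Ω → ℝ) (ω : Ω) : ℝ≥0∞ :=
  ⨅ (t : ℝ≥0) (_ : R t ω ≤ 0), (t : ℝ≥0∞)

/-- The random variable `(-1)^n t^{-n} G_n(0 | s_0, …, s_{n-1})` as a function of `s`. -/
def agWeight (n : ℕ) (t : ℝ) (s : Fin n → ℝ) : ℝ :=
  (-1) ^ n / t ^ n * (abelGontcharov n s).eval 0

/-- The regular conditional distribution of `(S_{v_0}, …, S_{v_{n-1}})` given `S_{v_n} = t`, where
`S_k` are the arrival times of `Md`. -/
def arrivalKernel (P : Measure Ω) [IsProbabilityMeasure P] (Md : ℝ≥0 → Ω → ℕ) (v : ℕ → ℕ)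
    (n : ℕ) : Kernel ℝ (Fin n → ℝ) :=
  condDistrib (fun ω (i : Fin n) => arrivalTime Md (v i) ω) (arrivalTime Md (v n)) P

/-- The `n`-th term
`E[(-1)^n t^{-n} G_n(0 | S_{v_0}, …, S_{v_{n-1}}) | S_{v_n} = t] f_{S_{v_n}}(t) P(N_t = n)`. -/
def ruinTerm (P : Measure Ω) [IsProbabilityMeasure P] (N Md : ℝ≥0 → Ω → ℕ) (v : ℕ → ℕ)
    (n : ℕ) (t : ℝ) : ℝ :=
  (∫ s, agWeight n t s ∂(arrivalKernel P Md v n t))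
    * (pdf (arrivalTime Md (v n)) P volume t).toReal
    * P.real {ω | N t.toNNReal ω = n}

/-- The random time `τ` has on `[0, ∞)` the (possibly defective) density
`f(t) = ∑ n, ruinTerm n t`, all the ingredients of this series being well defined: the arrival times
`S_{v_n}` have densities and, for almost every `t > 0`, the conditional expectations are integrals of
integrable functions and the series is a convergent series of nonnegative terms. -/
structure HasSeriesDensity (P : Measure Ω) [IsProbabilityMeasure P] (τ : Ω → ℝ≥0∞)
    (N Md : ℝ≥0 → Ω → ℕ) (v : ℕ → ℕ) : Prop where
  measurable : Measurable τ
  hasPDF : ∀ n, HasPDF (arrivalTime Md (v n)) P volume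
  integrable : ∀ᵐ t ∂(volume.restrict (Ioi (0 : ℝ))), ∀ n,
    Integrable (agWeight n t) (arrivalKernel P Md v n t)
  nonneg : ∀ᵐ t ∂(volume.restrict (Ioi (0 : ℝ))), ∀ n, 0 ≤ ruinTerm P N Md v n t
  summable : ∀ᵐ t ∂(volume.restrict (Ioi (0 : ℝ))), Summable fun n => ruinTerm P N Md v n t
  density : ∀ A : Set ℝ, MeasurableSet A → A ⊆ Ici 0 →
    P {ω | ∃ t ∈ A, τ ω = ENNReal.ofReal t}
      = ∫⁻ t in A, ENNReal.ofReal (∑' n, ruinTerm P N Md v n t)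

end PoolRuin

end

/-! Dividing the surplus by `w` shows that ruin at time `t` means `v (N t) ≤ Md t` for a monotone
sequence `v` of positive integers, so ruin is the first time `Md` reaches a level that moves with
`N`. With `T k` and `S k` the arrival times of `N` and `Md`, this happens almost surely only at some
`S (v n)` with `n` the current value of `N`, that is, when `T (k + 1) ≤ S (v k)` for all `k < n` and
`T n ≤ S (v n) < T (n + 1)` (`exists_hitting_iff`). These events are disjoint in `n`.

Since `N` and `Md` are independent, conditioning on the relevant arrival times of `Md` leaves a
question about `N` alone: for fixed times `s 0 ≤ … ≤ s n`, how likely is `N (s j) ≥ j + 1` for all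
`j < n` together with `N (s n) = n`? Splitting `{N (s n) = n}` according to the first `k` with `N (s
k) ≤ k` gives a triangular recursion. The Abel–Gontcharov expansion of `t ^ n` is the same
recursion, so the probability is `(-1) ^ n * G_n(0 | s)` times `exp (-(r * s n)) * r ^ n / n!`
(`IsPoissonProcess.real_firstTouch`), which is `agWeight` times `P (N (s n) = n)` when `s n > 0`.

Integrating against the conditional law of the earlier arrival times and the density of `S (v n)`
yields the `n`-th term (`measure_ruinEvent`). Summation over `n` gives the density; its total mass
is at most one, which forces convergence almost everywhere. -/

noncomputable section

namespace PoolRuin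

/-! ### Abel–Gontcharov expansions of powers -/

/-- Expansion of a shifted monomial in Abel–Gontcharov polynomials. -/
theorem sub_pow_eq_sum_abelGontcharov (t : ℝ) (n : ℕ) (U : ℕ → ℝ) :
    (X - C t : ℝ[X]) ^ n = ∑ k ∈ Finset.range (n + 1),
      C ((n.choose k : ℝ) * (U k - t) ^ (n - k)) * abelGontcharov k (fun i : Fin k => U i) := by
  induction n generalizing U with
  | zero => simp [abelGontcharov]
  | succ n ih =>
    have htail : ∀ k, Fin.tail (fun i : Fin (k + 1) => U i) = fun i : Fin k => U (i + 1) := by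
      intro k; ext i; simp [Fin.tail]
    have hder : derivative ((X - C t : ℝ[X]) ^ (n + 1)) =
        derivative (∑ k ∈ Finset.range (n + 1 + 1),
          C (((n + 1).choose k : ℝ) * (U k - t) ^ (n + 1 - k)) *
            abelGontcharov k (fun i : Fin k => U i)) := by
      rw [derivative_sum, Finset.sum_range_succ']
      simp only [derivative_C_mul, derivative_abelGontcharov, htail, abelGontcharov_zero,
        derivative_one, mul_zero, add_zero]
      rw [derivative_X_sub_C_pow, Nat.add_sub_cancel, ih (fun k => U (k + 1)), Finset.mul_sum]
      refine Finset.sum_congr rfl fun k _ => ?_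
      have h : ((n + 1).choose (k + 1) : ℝ) * (k + 1) = (n + 1) * n.choose k := by
        exact_mod_cast (Nat.add_one_mul_choose_eq n k).symm
      have hC : (C ((n + 1).choose (k + 1) : ℝ) * C (k + 1 : ℝ) : ℝ[X])
          = C (n + 1 : ℝ) * C (n.choose k : ℝ) := by
        rw [← C_mul, h, C_mul]
      rw [Nat.cast_add_one, Nat.add_sub_add_right, C_mul, C_mul]
      linear_combination (-(C ((U (k + 1) - t) ^ (n - k)) : ℝ[X]) *
        abelGontcharov k (fun i : Fin k => U (i + 1))) * hC
    -- Equal derivatives leave a constant, which is found at the first node `U 0`: every term with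
    -- `k ≥ 1` vanishes there, and the `k = 0` term equals the left-hand side.
    rw [← sub_eq_zero]
    generalize hq : (X - C t : ℝ[X]) ^ (n + 1) - _ = q
    obtain ⟨c, rfl⟩ := natDegree_eq_zero.1 (derivative_eq_zero.1
      (show derivative q = 0 by rw [← hq, derivative_sub, hder, sub_self]))
    have hev : (C c : ℝ[X]).eval (U 0) = 0 := by
      rw [← hq, eval_sub, eval_finsetSum, Finset.sum_range_succ', Finset.sum_eq_zero]
      · simp [abelGontcharov]
      · intro k _
        have := abelGontcharov_eval_first k (fun i : Fin (k + 1) => U i)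
        simp only [Fin.val_zero] at this
        simp [this]
    rw [eval_C] at hev
    rw [hev, C_0]

/-- Evaluation at `0`, with signs arranged so that `(t - U k) ^ (n - k)` can be read as a Poisson
weight for the increment from `U k` to `t`. -/
theorem pow_eq_sum_abelGontcharov_eval_zero (t : ℝ) (n : ℕ) (U : ℕ → ℝ) :
    t ^ n = ∑ k ∈ Finset.range (n + 1), (n.choose k : ℝ) * (t - U k) ^ (n - k) *
      ((-1) ^ k * (abelGontcharov k (fun i : Fin k => U i)).eval 0) := by
  have h := congrArg (fun p => (-1 : ℝ) ^ n * p.eval 0) (sub_pow_eq_sum_abelGontcharov t n U)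
  simp only [eval_pow, eval_sub, eval_X, eval_C, zero_sub, eval_finsetSum, eval_mul] at h
  rw [← mul_pow, neg_one_mul, neg_neg, Finset.mul_sum] at h
  rw [h]
  refine Finset.sum_congr rfl fun k hk => ?_
  obtain ⟨m, rfl⟩ := Nat.exists_eq_add_of_le (Finset.mem_range_succ_iff.1 hk)
  rw [Nat.add_sub_cancel_left, ← neg_sub (U k) t, neg_pow (U k - t) m, pow_add]
  ring

/-! ### Arrival times of counting paths -/

section ArrivalTimes

variable {Ω : Type*} {N : ℝ≥0 → Ω → ℕ}

/-- A right-continuous integer-valued path is constant on some interval to the right of `t`. -/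
theorem exists_forall_Ico_eq {f : ℝ≥0 → ℕ} {t : ℝ≥0} (h : ContinuousWithinAt f (Ici t) t) :
    ∃ c > t, ∀ s ∈ Ico t c, f s = f t := by
  have h1 : ∀ᶠ s in nhdsWithin t (Ici t), f s = f t := by
    have := h.eventually (p := fun m => m = f t) (by simp [nhds_discrete])
    exact this
  obtain ⟨c, hc, hcs⟩ := (mem_nhdsGE_iff_exists_Ico_subset).1 h1
  exact ⟨c, hc, fun s hs => hcs hs⟩

/-- The infimum is attained: the path is constant just to the right of it, and that interval
contains points where the level is reached. -/
theorem le_sInf_level {f : ℝ≥0 → ℕ} (hf : ∀ t, ContinuousWithinAt f (Ici t) t) {k : ℕ}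
    (hne : ∃ t, k ≤ f t) : k ≤ f (sInf {t | k ≤ f t}) := by
  obtain ⟨c, hc, hcs⟩ := exists_forall_Ico_eq (hf (sInf {t | k ≤ f t}))
  obtain ⟨s, hs, hsc⟩ := exists_lt_of_csInf_lt hne hc
  rw [← hcs s ⟨csInf_le (OrderBot.bddBelow _) hs, hsc⟩]
  exact hs

theorem le_iff_arrivalTime_le (hmono : ∀ ω, Monotone fun t => N t ω)
    (hr : ∀ ω t, ContinuousWithinAt (fun s => N s ω) (Ici t) t) {k : ℕ} {ω : Ω}
    (hne : ∃ t, k ≤ N t ω) (t : ℝ≥0) : k ≤ N t ω ↔ arrivalTime N k ω ≤ t := by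
  rw [arrivalTime, NNReal.coe_le_coe]
  refine ⟨fun h => csInf_le (OrderBot.bddBelow _) h, fun h => ?_⟩
  exact (le_sInf_level (hr ω) hne).trans (hmono ω h)

/-- The second alternative accounts for `sInf ∅ = 0` on paths that never reach `k`. Testing integer
times suffices by monotonicity, so measurability holds without discarding a null set. -/
theorem arrivalTime_le_iff (hmono : ∀ ω, Monotone fun t => N t ω)
    (hr : ∀ ω t, ContinuousWithinAt (fun s => N s ω) (Ici t) t) {k : ℕ} {ω : Ω} (t : ℝ≥0) :
    arrivalTime N k ω ≤ t ↔ k ≤ N t ω ∨ ∀ m : ℕ, N m ω < k := by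
  by_cases hne : ∃ t, k ≤ N t ω
  · rw [← le_iff_arrivalTime_le hmono hr hne]
    refine ⟨Or.inl, fun h => h.resolve_right fun h => ?_⟩
    obtain ⟨s, hs⟩ := hne
    obtain ⟨m, hm⟩ := exists_nat_ge s
    exact (h m).not_ge (hs.trans (hmono ω hm))
  · push Not at hne
    have : {t : ℝ≥0 | k ≤ N t ω} = ∅ := by ext t; simpa using hne t
    simp [arrivalTime, this, hne]

theorem arrivalTime_nonneg (k : ℕ) (ω : Ω) : 0 ≤ arrivalTime N k ω := NNReal.coe_nonneg _

theorem measurable_arrivalTime [MeasurableSpace Ω] (hN : ∀ t, Measurable (N t))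
    (hmono : ∀ ω, Monotone fun t => N t ω)
    (hr : ∀ ω t, ContinuousWithinAt (fun s => N s ω) (Ici t) t) (k : ℕ) :
    Measurable (arrivalTime N k) := by
  refine measurable_of_Iic fun x => ?_
  rcases lt_or_ge x 0 with hx | hx
  · convert MeasurableSet.empty
    ext ω
    simpa using hx.trans_le (arrivalTime_nonneg k ω)
  · lift x to ℝ≥0 using hx
    have : arrivalTime N k ⁻¹' Iic (x : ℝ) = {ω | k ≤ N x ω} ∪ ⋂ m : ℕ, {ω | N m ω < k} := by
      ext ω
      simp [arrivalTime_le_iff hmono hr]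
    rw [this]
    exact (measurableSet_le measurable_const (hN x)).union
      (MeasurableSet.iInter fun m => measurableSet_lt (hN m) measurable_const)

end ArrivalTimes

/-! ### Erlang laws and Poisson tails -/

section ErlangLaw

/-- Integral of the Erlang density. -/
theorem integral_erlang (r : ℝ) (k : ℕ) (x : ℝ) :
    ∫ y in (0 : ℝ)..x, r ^ (k + 1) / k.factorial * y ^ k * Real.exp (-(r * y))
      = 1 - ∑ j ∈ Finset.range (k + 1), Real.exp (-(r * x)) * (r * x) ^ j / j.factorial := by
  -- The antiderivative is minus a Poisson distribution function; its derivative telescopes in the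
  -- summation index.
  have hder : ∀ y ∈ uIcc 0 x, HasDerivAt
      (fun y => -∑ j ∈ Finset.range (k + 1), Real.exp (-(r * y)) * (r * y) ^ j / j.factorial)
      (r ^ (k + 1) / k.factorial * y ^ k * Real.exp (-(r * y))) y := by
    intro y hy
    clear hy
    induction k with
    | zero =>
      have h : HasDerivAt (fun y => Real.exp (-(r * y))) (Real.exp (-(r * y)) * -(r * 1)) y :=
        (((hasDerivAt_id y).const_mul r).neg).exp
      have h' : HasDerivAt (fun y => -Real.exp (-(r * y))) (-(Real.exp (-(r * y)) * -(r * 1))) y := h.neg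
      simpa [mul_comm] using h'
    | succ k ih =>
      have h1 : HasDerivAt (fun y => Real.exp (-(r * y))) (Real.exp (-(r * y)) * -(r * 1)) y :=
        (((hasDerivAt_id y).const_mul r).neg).exp
      have h2 : HasDerivAt (fun y => (r * y) ^ (k + 1)) (((k + 1 : ℕ) : ℝ) * (r * y) ^ k * (r * 1)) y :=
        ((hasDerivAt_id y).const_mul r).pow (k + 1)
      have h := (ih.sub ((h1.mul h2).div_const ((k + 1).factorial : ℝ)))
      refine (h.congr_deriv ?_).congr_of_eventuallyEq (Filter.Eventually.of_forall fun z => ?_)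
      · have : (k.factorial : ℝ) ≠ 0 := by positivity
        rw [Nat.factorial_succ]
        push_cast
        field_simp
        ring
      · simp only [Finset.sum_range_succ _ (k + 1), Pi.sub_apply, Pi.mul_apply]
        ring
  rw [intervalIntegral.integral_eq_sub_of_hasDerivAt hder
    (Continuous.intervalIntegrable (by fun_prop) _ _)]
  rw [Finset.sum_range_succ' _ k]
  simp [Finset.sum_range_succ' _ k]
  ring

theorem gammaMeasure_Iic_eq {r : ℝ≥0} (hr : 0 < r) (k : ℕ) (x : ℝ≥0) :
    (gammaMeasure (k + 1) r).real (Iic (x : ℝ)) = (poissonMeasure (r * x)).real (Ici (k + 1)) := by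
  have hr' : (0 : ℝ) < r := hr
  have := isProbabilityMeasure_gammaMeasure (a := k + 1) (by positivity) hr'
  rw [← cdf_eq_real, cdf_gammaMeasure_eq_integral (by positivity) hr']
  have h1 : ∫ y in Iic (x : ℝ), gammaPDFReal (k + 1) r y
      = ∫ y in (0 : ℝ)..x, (r : ℝ) ^ (k + 1) / k.factorial * y ^ k * Real.exp (-(r * y)) := by
    rw [intervalIntegral.integral_of_le x.coe_nonneg, ← integral_Icc_eq_integral_Ioc]
    rw [setIntegral_eq_of_subset_of_forall_sdiff_eq_zero (s := Icc (0 : ℝ) x) measurableSet_Iic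
      (fun y hy => hy.2)]
    · refine setIntegral_congr_fun measurableSet_Icc fun y hy => ?_
      simp only [gammaPDFReal, if_pos hy.1]
      rw [Real.Gamma_nat_eq_factorial, add_sub_cancel_right, Real.rpow_natCast]
      norm_cast
    · intro y hy
      have : ¬ 0 ≤ y := fun h => hy.2 ⟨h, hy.1⟩
      simp [gammaPDFReal, this]
  rw [h1, integral_erlang]
  have h2 : (Ici (k + 1) : Set ℕ) = (↑(Finset.range (k + 1)) : Set ℕ)ᶜ := by
    ext; simp
  rw [h2, probReal_compl_eq_one_sub (Finset.measurableSet _), ← sum_measureReal_singleton]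
  simp [poissonMeasure_real_singleton]

variable {Ω : Type*} [MeasurableSpace Ω] {P : Measure Ω}
  {N : ℝ≥0 → Ω → ℕ} {r : ℝ≥0}

theorem IsPoissonProcess.hasLaw (h : IsPoissonProcess N r P) (t : ℝ≥0) :
    HasLaw (N t) (poissonMeasure (r * t)) P := by
  simpa [h.zero] using h.law_increment 0 t zero_le

theorem IsPoissonProcess.measure_le [IsProbabilityMeasure P] (h : IsPoissonProcess N r P) (hr : 0 < r) (k : ℕ) (t : ℝ≥0) :
    P {ω | k + 1 ≤ N t ω} = gammaMeasure (k + 1) r (Iic (t : ℝ)) := by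
  have := isProbabilityMeasure_gammaMeasure (a := k + 1) (r := r) (by positivity) hr
  have h1 := gammaMeasure_Iic_eq hr k t
  rw [measureReal_def, measureReal_def, ENNReal.toReal_eq_toReal_iff' (by finiteness)
    (by finiteness), ← (h.hasLaw t).map_eq, Measure.map_apply (h.measurable t) measurableSet_Ici]
    at h1
  exact h1.symm

/-- The probability of having reached level `k + 1` by time `m` is an Erlang distribution function
at `m`, which tends to one. -/
theorem IsPoissonProcess.ae_exists_le [IsProbabilityMeasure P] (h : IsPoissonProcess N r P) (hr : 0 < r) :
    ∀ᵐ ω ∂P, ∀ k, ∃ t, k ≤ N t ω := by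
  rw [ae_all_iff]
  rintro (_ | k)
  · simp
  have := isProbabilityMeasure_gammaMeasure (a := k + 1) (r := r) (by positivity) hr
  have hmeas : MeasurableSet (⋃ m : ℕ, {ω | k + 1 ≤ N m ω}) :=
    MeasurableSet.iUnion fun m => measurableSet_le measurable_const (h.measurable m)
  have hP : P (⋃ m : ℕ, {ω | k + 1 ≤ N m ω}) = 1 := by
    refine le_antisymm prob_le_one ?_
    have hlim : Filter.Tendsto (fun m : ℕ => gammaMeasure (k + 1) r (Iic (m : ℝ))) Filter.atTop
        (nhds 1) := by
      rw [← measure_univ (μ := gammaMeasure (k + 1) r)]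
      exact (tendsto_measure_Iic_atTop _).comp tendsto_natCast_atTop_atTop
    refine le_of_tendsto' hlim fun m => ?_
    have := h.measure_le hr k m
    rw [NNReal.coe_natCast] at this
    rw [← this]
    exact measure_mono (subset_iUnion (fun m : ℕ => {ω | k + 1 ≤ N m ω}) m)
  filter_upwards [(mem_ae_iff_prob_eq_one hmeas).2 hP] with ω hω
  obtain ⟨m, hm⟩ := mem_iUnion.1 hω
  exact ⟨m, hm⟩

theorem IsPoissonProcess.measurable_arrivalTime (h : IsPoissonProcess N r P) (k : ℕ) :
    Measurable (arrivalTime N k) :=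
  PoolRuin.measurable_arrivalTime h.measurable h.mono h.rightCts k

/-- The arrival times of a Poisson process have Erlang laws. -/
theorem IsPoissonProcess.map_arrivalTime [IsProbabilityMeasure P] (h : IsPoissonProcess N r P) (hr : 0 < r) (k : ℕ) :
    P.map (arrivalTime N (k + 1)) = gammaMeasure (k + 1) r := by
  have := isProbabilityMeasure_gammaMeasure (a := k + 1) (r := r) (by positivity) hr
  have := Measure.isProbabilityMeasure_map (μ := P) (h.measurable_arrivalTime (k + 1)).aemeasurable
  refine Measure.ext_of_Iic _ _ fun x => ?_
  rw [Measure.map_apply (h.measurable_arrivalTime _) measurableSet_Iic]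
  rcases lt_or_ge x 0 with hx | hx
  · have h1 : arrivalTime N (k + 1) ⁻¹' Iic x = ∅ := by
      ext ω
      simpa using hx.trans_le (arrivalTime_nonneg _ ω)
    rw [h1, measure_empty, gammaMeasure, withDensity_apply _ measurableSet_Iic,
      setLIntegral_congr_fun measurableSet_Iic (g := fun _ => 0), lintegral_zero]
    exact fun y hy => gammaPDF_of_neg (lt_of_le_of_lt hy hx)
  · lift x to ℝ≥0 using hx
    rw [← h.measure_le hr k x]
    refine measure_congr ?_
    filter_upwards [h.ae_exists_le hr] with ω hω
    exact propext (le_iff_arrivalTime_le h.mono h.rightCts (hω _) x).symm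

end ErlangLaw

/-! ### First touching of a deterministic boundary -/

section BoundaryCrossing

variable {Ω : Type*} [MeasurableSpace Ω] {P : Measure Ω} {N : ℝ≥0 → Ω → ℕ} {r : ℝ≥0}

/-- The increment after time `s k` is independent of the values at the times `s 0, …, s k`. -/
theorem IsPoissonProcess.indepFun_past (h : IsPoissonProcess N r P) {s : ℕ → ℝ≥0}
    (hs : Monotone s) {k : ℕ} {t : ℝ≥0} (hst : s k ≤ t) :
    IndepFun (fun ω (j : Fin (k + 1)) => N (s j) ω) (fun ω => N t ω - N (s k) ω) P := by
  -- The grid is `0, s 0, …, s k, t, t, …`. Starting at `0` makes the values at `s 0, …, s k`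
  -- partial sums of increments `0, …, k`, while increment `k + 1` is the one after `s k`.
  let τ : ℕ → ℝ≥0 := fun j => if j = 0 then 0 else if j ≤ k + 1 then s (j - 1) else t
  have hτ : Monotone τ := by
    refine monotone_nat_of_le_succ fun j => ?_
    rcases j with _ | j
    · simp [τ]
    · simp only [τ, Nat.add_eq_zero_iff, one_ne_zero, and_false, if_false, Nat.add_sub_cancel]
      split_ifs with h1 h2
      · exact hs (Nat.le_succ j)
      · exact (hs (by lia)).trans hst
      · lia
      · exact le_rfl
  have hind := (h.indepIncrements.nat hτ).indepFun_finset (Finset.range (k + 1)) {k + 1}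
    (by simp) (fun i => (h.measurable _).sub (h.measurable _))
  have hsum : ∀ ω j, N (τ j) ω = ∑ i ∈ Finset.range j, (N (τ (i + 1)) ω - N (τ i) ω) := by
    intro ω j
    induction j with
    | zero => simp [τ, h.zero]
    | succ j ih =>
      rw [Finset.sum_range_succ, ← ih, Nat.add_sub_cancel' (h.mono ω (hτ (Nat.le_succ j)))]
  have hψ : Measurable fun d : ({k + 1} : Finset ℕ) → ℕ =>
      d ⟨k + 1, Finset.mem_singleton_self _⟩ := measurable_pi_apply _
  have hcomp := hind.comp
    (φ := fun d (j : Fin (k + 1)) => ∑ i : Fin (j + 1),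
      d ⟨i, Finset.mem_range.2 (lt_of_lt_of_le i.2 j.2)⟩)
    (by fun_prop) hψ
  convert hcomp using 1
  · ext ω j
    have hj : s j = τ (j + 1) := by
      have : (j : ℕ) ≤ k := Nat.lt_succ_iff.1 j.2
      simp [τ, this]
    rw [hj, hsum, Finset.sum_range]
    rfl
  · ext ω
    simp [τ]

/-- The event that the path lies strictly above the boundary `j ↦ s j` at the first `n` levels
and passes through level `n` at time `s n`. -/
def firstTouch (N : ℝ≥0 → Ω → ℕ) (s : ℕ → ℝ≥0) (n : ℕ) : Set Ω :=
  {ω | (∀ j < n, j + 1 ≤ N (s j) ω) ∧ N (s n) ω = n}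

theorem IsPoissonProcess.measurableSet_firstTouch (h : IsPoissonProcess N r P) (s : ℕ → ℝ≥0)
    (n : ℕ) : MeasurableSet (firstTouch N s n) := by
  have : firstTouch N s n = (⋂ j, ⋂ (_ : j < n), {ω | j + 1 ≤ N (s j) ω}) ∩ {ω | N (s n) ω = n} := by
    ext; simp [firstTouch]
  rw [this]
  exact (MeasurableSet.iInter fun j => MeasurableSet.iInter fun _ =>
    measurableSet_le measurable_const (h.measurable _)).inter
      (measurableSet_eq_fun (h.measurable _) measurable_const)

/-- On the first-touch event the path is at `k` at time `s k`, so reaching `n` at `s n` constrains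
only the increment, which is independent of the past. -/
theorem IsPoissonProcess.measure_firstTouch_inter (h : IsPoissonProcess N r P) {s : ℕ → ℝ≥0}
    (hs : Monotone s) {k n : ℕ} (hkn : k ≤ n) :
    P.real (firstTouch N s k ∩ {ω | N (s n) ω = n}) =
      P.real (firstTouch N s k) * (poissonMeasure (r * (s n - s k))).real {n - k} := by
  have hind := h.indepFun_past hs (hs hkn)
  let B : Set (Fin (k + 1) → ℕ) := {x | (∀ j : Fin (k + 1), (j : ℕ) < k → j + 1 ≤ x j) ∧
    x (Fin.last k) = k}
  have hB : firstTouch N s k = (fun ω (j : Fin (k + 1)) => N (s j) ω) ⁻¹' B := by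
    ext ω
    simp only [firstTouch, mem_ofPred_eq, B, mem_preimage, Fin.val_last]
    exact and_congr_left fun _ => ⟨fun H j hj => H j hj, fun H j hj => H ⟨j, by lia⟩ hj⟩
  have hD : firstTouch N s k ∩ {ω | N (s n) ω = n} =
      firstTouch N s k ∩ (fun ω => N (s n) ω - N (s k) ω) ⁻¹' {n - k} := by
    ext ω
    refine and_congr_right fun hω => ?_
    have h1 : N (s k) ω = k := hω.2
    have h2 : N (s k) ω ≤ N (s n) ω := h.mono ω (hs hkn)
    simp only [mem_ofPred_eq, mem_preimage, mem_singleton_iff]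
    lia
  have hlaw := (h.law_increment (s k) (s n) (hs hkn)).map_eq
  rw [hD, hB, measureReal_def, hind.measure_inter_preimage_eq_mul _ _ (MeasurableSet.of_discrete)
    (MeasurableSet.of_discrete), ENNReal.toReal_mul, ← hlaw, measureReal_def, measureReal_def,
    Measure.map_apply (f := fun ω => N (s n) ω - N (s k) ω)
      ((h.measurable _).sub (h.measurable _)) (measurableSet_singleton _)]

theorem IsPoissonProcess.real_eq (h : IsPoissonProcess N r P) (t : ℝ≥0) (n : ℕ) :
    P.real {ω | N t ω = n} = Real.exp (-(r * t)) * (r * t) ^ n / n.factorial := by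
  have := poissonMeasure_real_singleton (r * t) n
  rw [← (h.hasLaw t).map_eq, measureReal_def, Measure.map_apply (h.measurable t)
    (measurableSet_singleton _), ← measureReal_def, NNReal.coe_mul] at this
  exact this

/-- If `N (s n) = n`, there is a least `k ≤ n` with `N (s k) ≤ k`. Minimality gives `N (s (k - 1)) ≥
k` when `k > 0`, so monotonicity forces `N (s k) = k`. -/
theorem IsPoissonProcess.real_eq_sum_firstTouch [IsFiniteMeasure P] (h : IsPoissonProcess N r P)
    {s : ℕ → ℝ≥0} (hs : Monotone s) (n : ℕ) :
    P.real {ω | N (s n) ω = n} =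
      ∑ k ∈ Finset.range (n + 1), P.real (firstTouch N s k ∩ {ω | N (s n) ω = n}) := by
  rw [← measureReal_biUnion_finset]
  · congr 1
    ext ω
    simp only [mem_ofPred_eq, mem_iUnion, mem_inter_iff, exists_and_right, exists_prop,
      Finset.mem_range]
    refine ⟨fun hω => ⟨?_, hω⟩, fun hω => hω.2⟩
    have hex : ∃ k, N (s k) ω ≤ k := ⟨n, hω.le⟩
    classical
    have hpre : ∀ j < Nat.find hex, j + 1 ≤ N (s j) ω := fun j hj =>
      Nat.lt_iff_add_one_le.1 (not_le.1 (Nat.find_min hex hj))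
    refine ⟨Nat.find hex, Nat.lt_succ_iff.2 (Nat.find_min' hex hω.le), hpre,
      (Nat.find_spec hex).antisymm ?_⟩
    rcases hk : Nat.find hex with _ | j
    · exact Nat.zero_le _
    · exact (hpre j (by lia)).trans (h.mono ω (hs (Nat.le_succ j)))
  · intro k _ l _ hkl
    refine Set.disjoint_left.2 fun ω hk hl => ?_
    rcases lt_or_gt_of_ne hkl with hlt | hlt
    · have h1 := hl.1.1 k hlt
      have h2 := hk.1.2
      lia
    · have h1 := hk.1.1 l hlt
      have h2 := hl.1.2
      lia
  · intro k _
    exact (h.measurableSet_firstTouch s k).inter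
      (measurableSet_eq_fun (h.measurable _) measurable_const)

theorem IsPoissonProcess.real_firstTouch [IsFiniteMeasure P] (h : IsPoissonProcess N r P)
    {s : ℕ → ℝ≥0} (hs : Monotone s) (n : ℕ) :
    P.real (firstTouch N s n) = Real.exp (-(r * s n)) * (r : ℝ) ^ n / n.factorial *
      ((-1) ^ n * (abelGontcharov n (fun i : Fin n => (s i : ℝ))).eval 0) := by
  induction n using Nat.strong_induction_on with
  | _ n ih =>
    have h1 := h.real_eq_sum_firstTouch hs n
    rw [Finset.sum_range_succ, h.real_eq] at h1
    have h2 := pow_eq_sum_abelGontcharov_eval_zero (s n) n (fun i => (s i : ℝ))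
    rw [Finset.sum_range_succ] at h2
    have h3 : firstTouch N s n ∩ {ω | N (s n) ω = n} = firstTouch N s n :=
      inter_eq_left.2 fun ω hω => hω.2
    -- By induction the contributions with `k < n` agree with those of the polynomial expansion, so
    -- the remaining `k = n` terms agree too.
    have h4 : ∑ k ∈ Finset.range n, P.real (firstTouch N s k ∩ {ω | N (s n) ω = n}) =
        Real.exp (-(r * s n)) * (r : ℝ) ^ n / n.factorial *
        ∑ k ∈ Finset.range n, (n.choose k : ℝ) * ((s n : ℝ) - s k) ^ (n - k) *
          ((-1) ^ k * (abelGontcharov k (fun i : Fin k => (s i : ℝ))).eval 0) := by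
      rw [Finset.mul_sum]
      refine Finset.sum_congr rfl fun k hk => ?_
      have hkn := (Finset.mem_range.1 hk).le
      rw [h.measure_firstTouch_inter hs hkn, ih k (Finset.mem_range.1 hk),
        poissonMeasure_real_singleton, Nat.cast_choose ℝ hkn]
      have hexp : Real.exp (-(r * s n)) =
          Real.exp (-(r * s k)) * Real.exp (-((r * (s n - s k) : ℝ≥0) : ℝ)) := by
        rw [← Real.exp_add, NNReal.coe_mul, NNReal.coe_sub (hs hkn)]
        ring_nf
      rw [hexp, NNReal.coe_mul, NNReal.coe_sub (hs hkn), mul_pow,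
        show (r : ℝ) ^ n = r ^ k * r ^ (n - k) by rw [← pow_add, Nat.add_sub_cancel' hkn]]
      field_simp
    rw [h3, h4, mul_pow, h2] at h1
    simp only [Nat.choose_self, Nat.cast_one, Nat.sub_self, pow_zero, one_mul] at h1
    linear_combination -h1

end BoundaryCrossing

/-! ### Hitting a moving integer level -/

section Hitting

/-- Pathwise description of the first time at which `g` reaches the moving level `v (f t)`. -/
theorem exists_hitting_iff {f g : ℝ≥0 → ℕ} {S T : ℕ → ℝ} {v : ℕ → ℕ} {A : Set ℝ}
    (hf : ∀ t, ContinuousWithinAt f (Ici t) t) (hg : ∀ t, ContinuousWithinAt g (Ici t) t)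
    (hT : ∀ k (t : ℝ≥0), k ≤ f t ↔ T k ≤ t) (hS : ∀ k (t : ℝ≥0), k ≤ g t ↔ S k ≤ t)
    (hS0 : ∀ k, 0 ≤ S k) (hv : Monotone v) (hA : A ⊆ Ici 0) :
    (∃ t ∈ A, (⨅ (t : ℝ≥0) (_ : v (f t) ≤ g t), (t : ℝ≥0∞)) = ENNReal.ofReal t) ↔
      ∃ n, S (v n) ∈ A ∧ (∀ k < n, T (k + 1) ≤ S (v k)) ∧ T n ≤ S (v n) ∧
        S (v n) < T (n + 1) := by
  have hfmono : Monotone f := fun s t hst => by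
    rw [hT]
    exact ((hT _ s).1 le_rfl).trans hst
  have hSmono : ∀ j k, j ≤ k → S j ≤ S k := fun j k hjk => by
    have h1 := (hS k ⟨S k, hS0 k⟩).2 le_rfl
    exact (hS j ⟨S k, hS0 k⟩).1 (hjk.trans h1)
  constructor
  · rintro ⟨t, htA, ht⟩
    lift t to ℝ≥0 using hA htA
    rw [ENNReal.ofReal_coe_nnreal] at ht
    have hle : ∀ s, v (f s) ≤ g s → t ≤ s := fun s hs => by
      rw [← ENNReal.coe_le_coe, ← ht]
      exact iInf₂_le s hs
    -- The infimum is attained because both paths are constant immediately to the right of `t`.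
    have hatt : v (f t) ≤ g t := by
      obtain ⟨c, hc, hfc⟩ := exists_forall_Ico_eq (hf t)
      obtain ⟨d, hd, hgd⟩ := exists_forall_Ico_eq (hg t)
      have hlt : (⨅ (t : ℝ≥0) (_ : v (f t) ≤ g t), (t : ℝ≥0∞)) < (min c d : ℝ≥0) := by
        rw [ht, ENNReal.coe_lt_coe]
        exact lt_min hc hd
      simp only [iInf_lt_iff] at hlt
      obtain ⟨s, hs, hsc⟩ := hlt
      rw [ENNReal.coe_lt_coe, lt_min_iff] at hsc
      have hts := hle s hs
      rwa [hfc s ⟨hts, hsc.1⟩, hgd s ⟨hts, hsc.2⟩] at hs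
    have hmin : ∀ k ≤ f t, f ⟨S (v k), hS0 _⟩ ≤ k → (t : ℝ) ≤ S (v k) := fun k _ hfk => by
      have h1 := (hS (v k) ⟨S (v k), hS0 _⟩).2 le_rfl
      exact NNReal.coe_le_coe.2 (hle ⟨S (v k), hS0 _⟩ ((hv hfk).trans h1))
    have hSt : S (v (f t)) = t := by
      have h1 : S (v (f t)) ≤ t := (hS _ _).1 hatt
      exact h1.antisymm (hmin (f t) le_rfl (hfmono h1))
    refine ⟨f t, hSt ▸ htA, fun k hk => ?_, ?_, ?_⟩
    -- Were `T (k + 1)` later than `S (v k)`, then `f ≤ k` at time `S (v k)` and the moving level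
    -- would be reached there; hence `t ≤ S (v k)`, giving `f t ≤ k`.
    · have h3 := hSmono _ _ (hv hk.le)
      by_contra hcon
      have h1 : ¬ k + 1 ≤ f ⟨S (v k), hS0 _⟩ := fun h => hcon ((hT _ _).1 h)
      have h2 : t ≤ ⟨S (v k), hS0 _⟩ := hmin k hk.le (by lia)
      have := hfmono h2
      lia
    · rw [hSt]
      exact (hT _ _).1 le_rfl
    · rw [hSt, ← not_le, ← hT]
      simp
  · rintro ⟨n, hnA, hpre, h1, h2⟩
    refine ⟨S (v n), hnA, ?_⟩
    obtain ⟨s, hs⟩ : ∃ s : ℝ≥0, (s : ℝ) = S (v n) := ⟨⟨S (v n), hS0 _⟩, rfl⟩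
    rw [← hs] at h1 h2 ⊢
    rw [ENNReal.ofReal_coe_nnreal]
    have hfs : f s = n := by
      have h3 := (hT n s).2 h1
      have h4 : ¬ n + 1 ≤ f s := fun h => h2.not_ge ((hT _ _).1 h)
      lia
    have hgs : v n ≤ g s := (hS _ _).2 hs.ge
    refine le_antisymm (iInf₂_le s (by rwa [hfs])) (le_iInf₂ fun t ht => ?_)
    rw [ENNReal.coe_le_coe]
    by_contra! hts
    have hSt : S (v (f t)) ≤ t := (hS _ _).1 ht
    -- An earlier hit with `f t < n` would come after jump `f t + 1` of `f`, which is absurd; one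
    -- with `f t = n` would place `S (v n)` before itself.
    rcases (hfmono hts.le).lt_or_eq with hlt | heq
    · have h3 := (hT _ t).2 ((hpre (f t) (hfs ▸ hlt)).trans hSt)
      lia
    · rw [heq, hfs, ← hs, NNReal.coe_le_coe] at hSt
      exact hts.not_ge hSt

/-- The debut of a set whose sections are right-open and whose slices are measurable. -/
theorem measurable_debut {Ω : Type*} [MeasurableSpace Ω] {D : ℝ≥0 → Ω → Prop}
    (hD : ∀ t, MeasurableSet {ω | D t ω})
    (hr : ∀ ω t, D t ω → ∃ c > t, ∀ s ∈ Ico t c, D s ω) :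
    Measurable fun ω => ⨅ (t : ℝ≥0) (_ : D t ω), (t : ℝ≥0∞) := by
  obtain ⟨Q, hQc, hQd⟩ := TopologicalSpace.exists_countable_dense ℝ≥0
  refine measurable_of_Iio fun a => ?_
  have : (fun ω => ⨅ (t : ℝ≥0) (_ : D t ω), (t : ℝ≥0∞)) ⁻¹' Iio a =
      ⋃ q ∈ Q, {ω | (q : ℝ≥0∞) < a ∧ D q ω} := by
    ext ω
    simp only [mem_preimage, mem_Iio, iInf_lt_iff, mem_iUnion, mem_ofPred_eq, exists_prop]
    constructor
    · rintro ⟨t, ht, hta⟩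
      obtain ⟨c, hc, hcD⟩ := hr ω t ht
      obtain ⟨e, hte, hea⟩ := ENNReal.lt_iff_exists_nnreal_btwn.1 hta
      rw [ENNReal.coe_lt_coe] at hte
      obtain ⟨q, hq, htq, hqe⟩ := hQd.exists_between (lt_min hc hte)
      rw [lt_min_iff] at hqe
      exact ⟨q, hq, (ENNReal.coe_lt_coe.2 hqe.2).trans hea, hcD q ⟨htq.le, hqe.1⟩⟩
    · rintro ⟨q, _, hqa, hqD⟩
      exact ⟨q, hqD, hqa⟩
  rw [this]
  exact MeasurableSet.biUnion hQc fun q _ => (MeasurableSet.const _).inter (hD q)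

end Hitting

/-! ### Boundary crossing in terms of arrival times -/

section Crossing

/-- The pairs consisting of a sequence of level times `(y, x)` and a sequence `a` of jump times such
that the `(k + 1)`-st jump occurs before the level time `x k` and exactly `n` jumps occur
before `y`. -/
def crossingRegion (n : ℕ) : Set ((ℝ × (Fin n → ℝ)) × (ℕ → ℝ)) :=
  {z | (∀ i : Fin n, z.2 (i + 1) ≤ z.1.2 i) ∧ z.2 n ≤ z.1.1 ∧ z.1.1 < z.2 (n + 1)}

theorem measurableSet_crossingRegion (n : ℕ) : MeasurableSet (crossingRegion n) := by
  have : crossingRegion n = (⋂ i : Fin n, {z | z.2 (i + 1) ≤ z.1.2 i}) ∩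
      ({z | z.2 n ≤ z.1.1} ∩ {z | z.1.1 < z.2 (n + 1)}) := by
    ext; simp [crossingRegion]
  rw [this]
  refine (MeasurableSet.iInter fun i => measurableSet_le ?_ ?_).inter
    ((measurableSet_le ?_ ?_).inter (measurableSet_lt ?_ ?_)) <;> fun_prop

variable {Ω : Type*} [MeasurableSpace Ω] {P : Measure Ω}
  {N : ℝ≥0 → Ω → ℕ} {r : ℝ≥0}

theorem IsPoissonProcess.real_eq_pos (h : IsPoissonProcess N r P) (hr : 0 < r) {t : ℝ≥0}
    (ht : 0 < t) (n : ℕ) : 0 < P.real {ω | N t ω = n} := by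
  rw [h.real_eq]
  have : (0 : ℝ) < r := hr
  have : (0 : ℝ) < t := ht
  positivity

theorem IsPoissonProcess.measure_crossingRegion [IsProbabilityMeasure P] (h : IsPoissonProcess N r P) (hr : 0 < r) {n : ℕ}
    {y : ℝ} {x : Fin n → ℝ} (hy : 0 < y) (hx0 : ∀ i, 0 ≤ x i) (hx : Monotone x)
    (hxy : ∀ i, x i ≤ y) :
    P.real {ω | ((y, x), fun k => arrivalTime N k ω) ∈ crossingRegion n} =
      agWeight n y x * P.real {ω | N y.toNNReal ω = n} := by
  -- Continuing the node vector by the constant `y` makes `s n = y` and keeps the boundary monotone.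
  let s : ℕ → ℝ≥0 := fun j => if hj : j < n then (x ⟨j, hj⟩).toNNReal else y.toNNReal
  have hs : Monotone s := by
    intro i j hij
    simp only [s]
    split_ifs with h1 h2
    · exact Real.toNNReal_le_toNNReal (hx (Fin.mk_le_mk.2 hij))
    · exact Real.toNNReal_le_toNNReal (hxy _)
    · lia
    · exact le_rfl
  have hsn : s n = y.toNNReal := by simp [s]
  have hsy : (s n : ℝ) = y := by rw [hsn, Real.coe_toNNReal _ hy.le]
  have hsi : ∀ i : Fin n, (s i : ℝ) = x i := fun i => by simp [s, hx0 i]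
  have hset : P.real {ω | ((y, x), fun k => arrivalTime N k ω) ∈ crossingRegion n} =
      P.real (firstTouch N s n) := by
    refine measureReal_congr ?_
    filter_upwards [h.ae_exists_le hr] with ω hω
    have hT := fun k => le_iff_arrivalTime_le h.mono h.rightCts (hω k)
    refine propext ?_
    change (∀ i : Fin n, arrivalTime N (i + 1) ω ≤ x i) ∧ arrivalTime N n ω ≤ y ∧
      y < arrivalTime N (n + 1) ω ↔ (∀ j < n, j + 1 ≤ N (s j) ω) ∧ N (s n) ω = n
    rw [← hsy, ← not_le, ← hT, ← hT]
    refine and_congr ?_ (by lia)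
    simp only [← hsi, ← hT]
    exact ⟨fun H j hj => H ⟨j, hj⟩, fun H i => H i i.2⟩
  rw [hset, h.real_firstTouch hs, ← hsn, h.real_eq, agWeight, hsy]
  simp only [hsi]
  rw [mul_pow]
  field_simp

end Crossing

/-! ### Conditioning on `Md` and summing the series -/

section SeriesDensity

variable {Ω : Type*} [MeasurableSpace Ω] {P : Measure Ω}
  {N Md : ℝ≥0 → Ω → ℕ} {lam mud : ℝ≥0} {v : ℕ → ℕ}

theorem IsPoissonProcess.map_arrivalTime_of_pos [IsProbabilityMeasure P] (h : IsPoissonProcess N lam P) (hlam : 0 < lam)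
    {k : ℕ} (hk : 0 < k) : P.map (arrivalTime N k) = gammaMeasure k lam := by
  obtain ⟨k, rfl⟩ := Nat.exists_eq_succ_of_ne_zero hk.ne'
  simpa using h.map_arrivalTime hlam k

theorem IsPoissonProcess.hasPDF_arrivalTime [IsProbabilityMeasure P] (h : IsPoissonProcess N lam P) (hlam : 0 < lam)
    {k : ℕ} (hk : 0 < k) : HasPDF (arrivalTime N k) P volume :=
  hasPDF_of_map_eq_withDensity (h.measurable_arrivalTime k).aemeasurable (gammaPDF k lam)
    (measurable_gammaPDFReal _ _).ennreal_ofReal.aemeasurable (h.map_arrivalTime_of_pos hlam hk)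

/-- The gamma density is positive on `Ioi 0`, so null sets for the arrival law are Lebesgue null
there. -/
theorem IsPoissonProcess.ae_restrict_Ioi_of_ae_map [IsProbabilityMeasure P] (h : IsPoissonProcess N lam P)
    (hlam : 0 < lam) {k : ℕ} (hk : 0 < k) {p : ℝ → Prop}
    (hp : ∀ᵐ t ∂P.map (arrivalTime N k), p t) : ∀ᵐ t ∂volume.restrict (Ioi (0 : ℝ)), p t := by
  rw [h.map_arrivalTime_of_pos hlam hk, gammaMeasure,
    ae_withDensity_iff (f := gammaPDF k lam) (measurable_gammaPDFReal _ _).ennreal_ofReal] at hp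
  rw [ae_restrict_iff' measurableSet_Ioi]
  filter_upwards [hp] with t ht ht0
  refine ht ?_
  rw [gammaPDF, Ne, ENNReal.ofReal_eq_zero, not_le]
  exact gammaPDFReal_pos (by exact_mod_cast hk) hlam ht0

theorem IsPoissonProcess.ae_arrivalTime_pos [IsProbabilityMeasure P] (h : IsPoissonProcess N lam P) (hlam : 0 < lam)
    {k : ℕ} (hk : 0 < k) : ∀ᵐ ω ∂P, 0 < arrivalTime N k ω := by
  have := h.hasPDF_arrivalTime hlam hk
  have hne : ∀ᵐ t ∂P.map (arrivalTime N k), t ≠ 0 :=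
    HasPDF.absolutelyContinuous.ae_le (Measure.ae_ne volume 0)
  filter_upwards [ae_of_ae_map (h.measurable_arrivalTime k).aemeasurable hne] with ω hω
  exact (arrivalTime_nonneg k ω).lt_of_ne' hω

theorem IsPoissonProcess.arrivalTime_mono (h : IsPoissonProcess N lam P) {ω : Ω}
    (hω : ∀ k, ∃ t, k ≤ N t ω) : Monotone fun k => arrivalTime N k ω := fun j k hjk => by
  obtain ⟨t, ht⟩ : ∃ t : ℝ≥0, (t : ℝ) = arrivalTime N k ω := ⟨_, rfl⟩
  have h1 := (le_iff_arrivalTime_le h.mono h.rightCts (hω k) t).2 ht.ge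
  have h2 := (le_iff_arrivalTime_le h.mono h.rightCts (hω j) t).1 (hjk.trans h1)
  exact h2.trans ht.le

theorem measurable_arrivalTimes (hMd : IsPoissonProcess Md mud P) (v : ℕ → ℕ) (n : ℕ) :
    Measurable fun ω (i : Fin n) => arrivalTime Md (v i) ω :=
  measurable_pi_lambda _ fun i => hMd.measurable_arrivalTime (v i)

instance [IsProbabilityMeasure P] (n : ℕ) : IsMarkovKernel (arrivalKernel P Md v n) := by
  unfold arrivalKernel; infer_instance

theorem map_compProd_arrivalKernel [IsProbabilityMeasure P] (hMd : IsPoissonProcess Md mud P) (v : ℕ → ℕ) (n : ℕ) :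
    (P.map (arrivalTime Md (v n))).compProd (arrivalKernel P Md v n) =
      P.map fun ω => (arrivalTime Md (v n) ω, fun i : Fin n => arrivalTime Md (v i) ω) :=
  compProd_map_condDistrib (measurable_arrivalTimes hMd v n).aemeasurable

/-- Almost surely, the conditional law of the earlier arrival times is carried by ordered
vectors. -/
theorem ae_arrivalKernel [IsProbabilityMeasure P] (hMd : IsPoissonProcess Md mud P) (hmud : 0 < mud) (hv : Monotone v)
    (hv0 : ∀ n, 0 < v n) (n : ℕ) :
    ∀ᵐ t ∂P.map (arrivalTime Md (v n)), ∀ᵐ x ∂arrivalKernel P Md v n t,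
      0 < t ∧ (∀ i, 0 ≤ x i) ∧ Monotone x ∧ ∀ i, x i ≤ t := by
  refine Measure.ae_ae_of_ae_compProd (p := fun z : ℝ × (Fin n → ℝ) =>
    0 < z.1 ∧ (∀ i, 0 ≤ z.2 i) ∧ Monotone z.2 ∧ ∀ i, z.2 i ≤ z.1) ?_
  rw [map_compProd_arrivalKernel hMd, ae_map_iff (by
    exact ((hMd.measurable_arrivalTime _).prodMk (measurable_arrivalTimes hMd v n)).aemeasurable)]
  · filter_upwards [hMd.ae_exists_le hmud, hMd.ae_arrivalTime_pos hmud (hv0 n)] with ω hω hpos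
    have hmono := hMd.arrivalTime_mono hω
    exact ⟨hpos, fun i => arrivalTime_nonneg _ _, fun i j hij => hmono (hv hij),
      fun i => hmono (hv i.2.le)⟩
  · have : {z : ℝ × (Fin n → ℝ) | 0 < z.1 ∧ (∀ i, 0 ≤ z.2 i) ∧ Monotone z.2 ∧ ∀ i, z.2 i ≤ z.1} =
        {z | 0 < z.1} ∩ ((⋂ i, {z | 0 ≤ z.2 i}) ∩
          ((⋂ i, ⋂ j, ⋂ (_ : i ≤ j), {z | z.2 i ≤ z.2 j}) ∩ ⋂ i, {z | z.2 i ≤ z.1})) := by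
      ext z
      simp [Monotone]
    rw [this]
    refine (measurableSet_lt measurable_const measurable_fst).inter
      ((MeasurableSet.iInter fun i => measurableSet_le measurable_const (by fun_prop)).inter
        ((MeasurableSet.iInter fun i => MeasurableSet.iInter fun j => MeasurableSet.iInter
          fun _ => measurableSet_le (by fun_prop) (by fun_prop)).inter
            (MeasurableSet.iInter fun i => measurableSet_le (by fun_prop) (by fun_prop))))

/-- The probability that `N` crosses the boundary made of the level times `z` for the first time
at the last of them, with `n` jumps. -/
def crossingProb (P : Measure Ω) (N : ℝ≥0 → Ω → ℕ) (n : ℕ) (z : ℝ × (Fin n → ℝ)) : ℝ≥0∞ :=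
  P.map (fun ω k => arrivalTime N k ω) (Prod.mk z ⁻¹' crossingRegion n)

theorem measurable_crossingProb [IsProbabilityMeasure P] (hN : IsPoissonProcess N lam P) (n : ℕ) :
    Measurable (crossingProb P N n) := by
  have := Measure.isProbabilityMeasure_map (μ := P) (f := fun ω k => arrivalTime N k ω)
    (measurable_pi_lambda _ fun k => hN.measurable_arrivalTime k).aemeasurable
  exact measurable_measure_prodMk_left (measurableSet_crossingRegion n)

theorem crossingProb_le_one [IsProbabilityMeasure P] (hN : IsPoissonProcess N lam P) (n : ℕ) (z : ℝ × (Fin n → ℝ)) :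
    crossingProb P N n z ≤ 1 := by
  have := Measure.isProbabilityMeasure_map (μ := P) (f := fun ω k => arrivalTime N k ω)
    (measurable_pi_lambda _ fun k => hN.measurable_arrivalTime k).aemeasurable
  exact prob_le_one

theorem toReal_crossingProb [IsProbabilityMeasure P] (hN : IsPoissonProcess N lam P) (hlam : 0 < lam) {n : ℕ}
    {y : ℝ} {x : Fin n → ℝ} (hy : 0 < y) (hx0 : ∀ i, 0 ≤ x i) (hx : Monotone x)
    (hxy : ∀ i, x i ≤ y) :
    (crossingProb P N n (y, x)).toReal = agWeight n y x * P.real {ω | N y.toNNReal ω = n} := by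
  rw [← hN.measure_crossingRegion hlam hy hx0 hx hxy, crossingProb, Measure.map_apply
    (measurable_pi_lambda _ fun k => hN.measurable_arrivalTime k)
    (measurable_prodMk_left (measurableSet_crossingRegion n))]
  rfl

/-- On the ordered vectors that carry the kernel, `agWeight` is a crossing probability divided by
the positive constant `P (N t = n)`. Boundedness and sign come from this, not from the polynomial.
-/
theorem ae_integrable_agWeight [IsProbabilityMeasure P] (hN : IsPoissonProcess N lam P) (hMd : IsPoissonProcess Md mud P)
    (hlam : 0 < lam) (hmud : 0 < mud) (hv : Monotone v) (hv0 : ∀ n, 0 < v n) (n : ℕ) :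
    ∀ᵐ t ∂P.map (arrivalTime Md (v n)), Integrable (agWeight n t) (arrivalKernel P Md v n t) ∧
      0 ≤ ∫ s, agWeight n t s ∂arrivalKernel P Md v n t ∧
      ∫⁻ x, crossingProb P N n (t, x) ∂arrivalKernel P Md v n t =
        ENNReal.ofReal ((∫ s, agWeight n t s ∂arrivalKernel P Md v n t) *
          P.real {ω | N t.toNNReal ω = n}) := by
  filter_upwards [ae_arrivalKernel hMd hmud hv hv0 n] with t ht
  have ht0 : 0 < t := ht.exists.choose_spec.1
  have hp : 0 < P.real {ω | N t.toNNReal ω = n} :=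
    hN.real_eq_pos hlam (Real.toNNReal_pos.2 ht0) n
  have hae : ∀ᵐ x ∂arrivalKernel P Md v n t,
      (crossingProb P N n (t, x)).toReal = agWeight n t x * P.real {ω | N t.toNNReal ω = n} := by
    filter_upwards [ht] with x hx
    exact toReal_crossingProb hN hlam hx.1 hx.2.1 hx.2.2.1 hx.2.2.2
  have hmeas : Measurable fun x => crossingProb P N n (t, x) :=
    (measurable_crossingProb hN n).comp measurable_prodMk_left
  have hfin : ∀ x, crossingProb P N n (t, x) ≠ ∞ := fun x =>
    ((crossingProb_le_one hN n _).trans_lt ENNReal.one_lt_top).ne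
  have hintQ : Integrable (fun x => (crossingProb P N n (t, x)).toReal)
      (arrivalKernel P Md v n t) := by
    refine Integrable.of_bound hmeas.ennreal_toReal.aestronglyMeasurable 1
      (Filter.Eventually.of_forall fun x => ?_)
    rw [Real.norm_of_nonneg ENNReal.toReal_nonneg]
    exact ENNReal.toReal_le_of_le_ofReal zero_le_one (by simpa using crossingProb_le_one hN n _)
  have hint : Integrable (agWeight n t) (arrivalKernel P Md v n t) := by
    refine (hintQ.div_const (P.real {ω | N t.toNNReal ω = n})).congr ?_
    filter_upwards [hae] with x hx
    rw [hx, mul_div_cancel_right₀ _ hp.ne']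
  refine ⟨hint, integral_nonneg_of_ae ?_, ?_⟩
  · filter_upwards [hae] with x hx
    exact nonneg_of_mul_nonneg_left (hx ▸ ENNReal.toReal_nonneg) hp
  · rw [← integral_mul_const, ← integral_congr_ae hae,
      ofReal_integral_eq_lintegral_ofReal hintQ
        (Filter.Eventually.of_forall fun _ => ENNReal.toReal_nonneg)]
    exact lintegral_congr fun x => (ENNReal.ofReal_toReal (hfin x)).symm

theorem ae_ofReal_ruinTerm [IsProbabilityMeasure P] (hN : IsPoissonProcess N lam P) (hMd : IsPoissonProcess Md mud P)
    (hlam : 0 < lam) (hmud : 0 < mud) (hv : Monotone v) (hv0 : ∀ n, 0 < v n) (n : ℕ) :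
    ∀ᵐ t ∂volume, pdf (arrivalTime Md (v n)) P volume t *
        ∫⁻ x, crossingProb P N n (t, x) ∂arrivalKernel P Md v n t =
      ENNReal.ofReal (ruinTerm P N Md v n t) := by
  have := hMd.hasPDF_arrivalTime hmud (hv0 n)
  have h := ae_integrable_agWeight hN hMd hlam hmud hv hv0 n
  rw [map_eq_withDensity_pdf (arrivalTime Md (v n)) P volume,
    ae_withDensity_iff (measurable_pdf _ _ _)] at h
  filter_upwards [h, (pdf.ae_lt_top :
    ∀ᵐ t ∂volume, pdf (arrivalTime Md (v n)) P volume t < ∞)] with t ht hlt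
  rw [ruinTerm]
  by_cases h0 : pdf (arrivalTime Md (v n)) P volume t = 0
  · simp [h0]
  · obtain ⟨-, hnn, heq⟩ := ht h0
    rw [heq, mul_right_comm, ENNReal.ofReal_mul (mul_nonneg hnn measureReal_nonneg),
      ENNReal.ofReal_toReal hlt.ne, mul_comm]

theorem indepFun_arrivalTimes [IsProbabilityMeasure P] (hN : IsPoissonProcess N lam P) (hMd : IsPoissonProcess Md mud P)
    (hindep : IndepFun (fun ω t => N t ω) (fun ω t => Md t ω) P) (v : ℕ → ℕ) (n : ℕ) :
    IndepFun (fun ω => (arrivalTime Md (v n) ω, fun i : Fin n => arrivalTime Md (v i) ω))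
      (fun ω k => arrivalTime N k ω) P := by
  -- Arrival times are measurable for the σ-algebra generated by their own process, so they inherit
  -- independence.
  have key : ∀ {M : ℝ≥0 → Ω → ℕ} {r : ℝ≥0}, IsPoissonProcess M r P → ∀ k,
      Measurable[MeasurableSpace.comap (fun ω t => M t ω) MeasurableSpace.pi] (arrivalTime M k) :=
    fun {M} _ hM k => @measurable_arrivalTime _ _ (MeasurableSpace.comap _ _)
      (fun t => (measurable_pi_apply t).comp (comap_measurable fun ω t => M t ω))
      hM.mono hM.rightCts k
  rw [IndepFun_iff_Indep] at hindep ⊢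
  refine indep_of_indep_of_le_left (indep_of_indep_of_le_right hindep.symm ?_) ?_
  · exact Measurable.comap_le (@measurable_pi_lambda _ _ _ (MeasurableSpace.comap _ _) _ _
      fun k => key hN k)
  · have hvec : Measurable[MeasurableSpace.comap (fun ω t => Md t ω) MeasurableSpace.pi]
        fun ω (i : Fin n) => arrivalTime Md (v i) ω :=
      @measurable_pi_lambda _ _ _ (MeasurableSpace.comap _ _) _ _ fun i => key hMd _
    exact Measurable.comap_le ((key hMd _).prodMk hvec)

/-- The event that ruin occurs at the arrival time `S_{v n}`, lying in `A`, with exactly `n` jumps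
of `N` before. -/
def ruinEvent (N Md : ℝ≥0 → Ω → ℕ) (v : ℕ → ℕ) (A : Set ℝ) (n : ℕ) : Set Ω :=
  {ω | arrivalTime Md (v n) ω ∈ A ∧
    (∀ k < n, arrivalTime N (k + 1) ω ≤ arrivalTime Md (v k) ω) ∧
    arrivalTime N n ω ≤ arrivalTime Md (v n) ω ∧
    arrivalTime Md (v n) ω < arrivalTime N (n + 1) ω}

theorem ruinEvent_eq {Ω : Type*} {N Md : ℝ≥0 → Ω → ℕ} (v : ℕ → ℕ) (A : Set ℝ) (n : ℕ) :
    ruinEvent N Md v A n =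
      (fun ω => ((arrivalTime Md (v n) ω, fun i : Fin n => arrivalTime Md (v i) ω),
        fun k => arrivalTime N k ω)) ⁻¹' (((Prod.fst ∘ Prod.fst) ⁻¹' A) ∩ crossingRegion n) := by
  ext ω
  refine and_congr_right fun _ => and_congr_left fun _ => ?_
  exact ⟨fun H i => H i i.2, fun H j hj => H ⟨j, hj⟩⟩

theorem measurableSet_ruinEvent (hN : IsPoissonProcess N lam P) (hMd : IsPoissonProcess Md mud P)
    (v : ℕ → ℕ) {A : Set ℝ} (hA : MeasurableSet A) (n : ℕ) :
    MeasurableSet (ruinEvent N Md v A n) := by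
  rw [ruinEvent_eq]
  exact (((hMd.measurable_arrivalTime _).prodMk (measurable_arrivalTimes hMd v n)).prodMk
    (measurable_pi_lambda _ fun k => hN.measurable_arrivalTime k))
    ((hA.preimage (by fun_prop)).inter (measurableSet_crossingRegion n))

/-- For `m < n`, event `n` requires `T (m + 1) ≤ S (v m)`, while event `m` requires the opposite
strict inequality. -/
theorem pairwise_disjoint_ruinEvent {Ω : Type*} {N Md : ℝ≥0 → Ω → ℕ} (v : ℕ → ℕ) (A : Set ℝ) :
    Pairwise (Function.onFun Disjoint (ruinEvent N Md v A)) := by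
  have key : ∀ m n, m < n → Disjoint (ruinEvent N Md v A m) (ruinEvent N Md v A n) := by
    refine fun m n hmn => Set.disjoint_left.2 fun ω hm hn => ?_
    exact (hn.2.1 m hmn).not_gt hm.2.2.2
  intro m n hmn
  rcases lt_or_gt_of_ne hmn with h | h
  · exact key m n h
  · exact (key n m h).symm

/-- Independence turns the joint law into a product, so Fubini freezes the arrival times of `Md`;
disintegrating their law along `arrivalKernel` then leaves the density of `S (v n)`. -/
theorem measure_ruinEvent [IsProbabilityMeasure P] (hN : IsPoissonProcess N lam P) (hMd : IsPoissonProcess Md mud P)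
    (hlam : 0 < lam) (hmud : 0 < mud)
    (hindep : IndepFun (fun ω t => N t ω) (fun ω t => Md t ω) P)
    (hv : Monotone v) (hv0 : ∀ n, 0 < v n) {A : Set ℝ} (hA : MeasurableSet A) (n : ℕ) :
    P (ruinEvent N Md v A n) = ∫⁻ t in A, ENNReal.ofReal (ruinTerm P N Md v n t) := by
  have hT : Measurable fun ω k => arrivalTime N k ω :=
    measurable_pi_lambda _ fun k => hN.measurable_arrivalTime k
  have hS := (hMd.measurable_arrivalTime (v n)).prodMk (measurable_arrivalTimes hMd v n)
  have := hMd.hasPDF_arrivalTime hmud (hv0 n)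
  have := Measure.isProbabilityMeasure_map (μ := P) hT.aemeasurable
  have := Measure.isProbabilityMeasure_map (μ := P) hS.aemeasurable
  have := Measure.isProbabilityMeasure_map (μ := P)
    (hMd.measurable_arrivalTime (v n)).aemeasurable
  have hAC : MeasurableSet (((Prod.fst ∘ Prod.fst) ⁻¹' A) ∩ crossingRegion n) :=
    (hA.preimage (by fun_prop)).inter (measurableSet_crossingRegion n)
  have hmeasQ : Measurable fun t =>
      ∫⁻ x, crossingProb P N n (t, x) ∂arrivalKernel P Md v n t :=
    (measurable_crossingProb hN n).lintegral_kernel_prod_right'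
  have hind : ∀ z : ℝ × (Fin n → ℝ), P.map (fun ω k => arrivalTime N k ω)
      (Prod.mk z ⁻¹' (((Prod.fst ∘ Prod.fst) ⁻¹' A) ∩ crossingRegion n)) =
        (Prod.fst ⁻¹' A).indicator (crossingProb P N n) z := by
    intro z
    by_cases hz : z.1 ∈ A
    · rw [indicator_of_mem (by exact hz), crossingProb]
      congr 1
      ext a
      exact and_iff_right hz
    · rw [indicator_of_notMem (by exact hz)]
      refine (congrArg _ ?_).trans measure_empty
      ext a
      simp [hz]
  rw [ruinEvent_eq, ← Measure.map_apply (hS.prodMk hT) hAC,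
    (indepFun_arrivalTimes hN hMd hindep v n).map_prod_eq_prod_map_map hS.aemeasurable
      hT.aemeasurable, Measure.prod_apply hAC]
  simp_rw [hind]
  rw [← map_compProd_arrivalKernel hMd, Measure.lintegral_compProd
    ((measurable_crossingProb hN n).indicator (measurable_fst hA))]
  calc ∫⁻ t, ∫⁻ x, (Prod.fst ⁻¹' A).indicator (crossingProb P N n) (t, x)
          ∂arrivalKernel P Md v n t ∂P.map (arrivalTime Md (v n))
      = ∫⁻ t in A, ∫⁻ x, crossingProb P N n (t, x) ∂arrivalKernel P Md v n t
          ∂P.map (arrivalTime Md (v n)) := by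
        rw [← lintegral_indicator hA]
        refine lintegral_congr fun t => ?_
        by_cases ht : t ∈ A
        · rw [indicator_of_mem ht]
          exact lintegral_congr fun x => indicator_of_mem (by exact ht) _
        · rw [indicator_of_notMem ht, ← lintegral_zero]
          exact lintegral_congr fun x => indicator_of_notMem (by exact ht) _
    _ = ∫⁻ t in A, pdf (arrivalTime Md (v n)) P volume t *
          ∫⁻ x, crossingProb P N n (t, x) ∂arrivalKernel P Md v n t := by
        rw [map_eq_withDensity_pdf (arrivalTime Md (v n)) P volume,
          setLIntegral_withDensity_eq_setLIntegral_mul _ (measurable_pdf _ _ _) hmeasQ hA]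
        rfl
    _ = _ := lintegral_congr_ae (ae_restrict_of_ae
        (ae_ofReal_ruinTerm hN hMd hlam hmud hv hv0 n))

theorem measure_iUnion_ruinEvent [IsProbabilityMeasure P] (hN : IsPoissonProcess N lam P)
    (hMd : IsPoissonProcess Md mud P) (hlam : 0 < lam) (hmud : 0 < mud)
    (hindep : IndepFun (fun ω t => N t ω) (fun ω t => Md t ω) P)
    (hv : Monotone v) (hv0 : ∀ n, 0 < v n) {A : Set ℝ} (hA : MeasurableSet A) :
    P (⋃ n, ruinEvent N Md v A n) =
      ∫⁻ t in A, ∑' n, ENNReal.ofReal (ruinTerm P N Md v n t) := by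
  rw [measure_iUnion (pairwise_disjoint_ruinEvent v A)
    (fun n => measurableSet_ruinEvent hN hMd v hA n), lintegral_tsum]
  · exact tsum_congr fun n => measure_ruinEvent hN hMd hlam hmud hindep hv hv0 hA n
  · intro n
    refine AEMeasurable.congr (Measurable.aemeasurable ?_)
      (ae_restrict_of_ae (ae_ofReal_ruinTerm hN hMd hlam hmud hv hv0 n))
    exact (measurable_pdf _ _ _).mul (measurable_crossingProb hN n).lintegral_kernel_prod_right'

/-- The first time at which `Md` reaches the moving level `v (N t)` has the series density. -/
theorem hasSeriesDensity_hitting [IsProbabilityMeasure P] (hN : IsPoissonProcess N lam P)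
    (hMd : IsPoissonProcess Md mud P) (hlam : 0 < lam) (hmud : 0 < mud)
    (hindep : IndepFun (fun ω t => N t ω) (fun ω t => Md t ω) P)
    (hv : Monotone v) (hv0 : ∀ n, 0 < v n) :
    HasSeriesDensity P (fun ω => ⨅ (t : ℝ≥0) (_ : v (N t ω) ≤ Md t ω), (t : ℝ≥0∞)) N Md v := by
  have hnonneg : ∀ᵐ t ∂volume.restrict (Ioi (0 : ℝ)), ∀ n, 0 ≤ ruinTerm P N Md v n t := by
    rw [ae_all_iff]
    intro n
    filter_upwards [hMd.ae_restrict_Ioi_of_ae_map hmud (hv0 n)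
      (ae_integrable_agWeight hN hMd hlam hmud hv hv0 n)] with t ht
    exact mul_nonneg (mul_nonneg ht.2.1 ENNReal.toReal_nonneg) measureReal_nonneg
  have hsum : ∀ᵐ t ∂volume.restrict (Ioi (0 : ℝ)), Summable fun n => ruinTerm P N Md v n t := by
    -- The series integrates to a probability, hence is finite almost everywhere.
    have hfin := measure_iUnion_ruinEvent hN hMd hlam hmud hindep hv hv0
      (measurableSet_Ioi (a := (0 : ℝ)))
    have hmeas : AEMeasurable (fun t => ∑' n, ENNReal.ofReal (ruinTerm P N Md v n t))
        (volume.restrict (Ioi (0 : ℝ))) := by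
      refine AEMeasurable.tsum fun n => AEMeasurable.congr (Measurable.aemeasurable ?_)
        (ae_restrict_of_ae (ae_ofReal_ruinTerm hN hMd hlam hmud hv hv0 n))
      exact (measurable_pdf _ _ _).mul
        (measurable_crossingProb hN n).lintegral_kernel_prod_right'
    filter_upwards [hnonneg, ae_lt_top' hmeas (hfin ▸ measure_ne_top P _)] with t ht hlt
    refine (ENNReal.summable_toReal hlt.ne).congr fun n => ?_
    exact ENNReal.toReal_ofReal (ht n)
  refine ⟨?_, fun n => hMd.hasPDF_arrivalTime hmud (hv0 n), ?_, hnonneg, hsum, ?_⟩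
  · refine measurable_debut (D := fun t ω => v (N t ω) ≤ Md t ω) (fun t => ?_) fun ω t h => ?_
    · exact measurableSet_le ((measurable_of_countable v).comp (hN.measurable t))
        (hMd.measurable t)
    · obtain ⟨c, hc, hNc⟩ := exists_forall_Ico_eq (hN.rightCts ω t)
      obtain ⟨d, hd, hMc⟩ := exists_forall_Ico_eq (hMd.rightCts ω t)
      refine ⟨min c d, lt_min hc hd, fun s hs => ?_⟩
      have hs2 := lt_min_iff.1 hs.2
      rwa [hNc s ⟨hs.1, hs2.1⟩, hMc s ⟨hs.1, hs2.2⟩]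
  · rw [ae_all_iff]
    intro n
    filter_upwards [hMd.ae_restrict_Ioi_of_ae_map hmud (hv0 n)
      (ae_integrable_agWeight hN hMd hlam hmud hv hv0 n)] with t ht using ht.1
  · intro A hA hA0
    have hset : P {ω | ∃ t ∈ A, (⨅ (t : ℝ≥0) (_ : v (N t ω) ≤ Md t ω), (t : ℝ≥0∞)) =
        ENNReal.ofReal t} = P (⋃ n, ruinEvent N Md v A n) := by
      refine measure_congr ?_
      filter_upwards [hN.ae_exists_le hlam, hMd.ae_exists_le hmud] with ω hNω hMω
      refine propext (Iff.trans (exists_hitting_iff (hN.rightCts ω) (hMd.rightCts ω)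
        (fun k => le_iff_arrivalTime_le hN.mono hN.rightCts (hNω k))
        (fun k => le_iff_arrivalTime_le hMd.mono hMd.rightCts (hMω k))
        (fun k => arrivalTime_nonneg k ω) hv hA0)
        (mem_iUnion (s := ruinEvent N Md v A) (x := ω)).symm)
    rw [hset, measure_iUnion_ruinEvent hN hMd hlam hmud hindep hv hv0 hA]
    refine lintegral_congr_ae (ae_restrict_of_ae_restrict_of_subset hA0 ?_)
    -- The endpoint `0` is Lebesgue null, so the almost-everywhere statements on `Ioi 0` suffice.
    rw [← restrict_Ioi_eq_restrict_Ici]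
    filter_upwards [hnonneg, hsum] with t ht hst
    exact (ENNReal.ofReal_tsum_of_nonneg ht hst).symm

end SeriesDensity

/-! ### From the surplus to integer levels -/

section Surplus

variable {u w b : ℝ}

theorem barrier_pos (hu : 0 < u) (hw : 0 < w) (hwb : w < b) (n : ℕ) :
    0 < (n : ℝ) * (b - w) / w + u / w := by
  have : 0 < b - w := sub_pos.2 hwb
  positivity

theorem monotone_barrier (hw : 0 < w) (hwb : w < b) :
    Monotone fun n : ℕ => (n : ℝ) * (b - w) / w + u / w := by
  intro m n hmn
  have : 0 < b - w := sub_pos.2 hwb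
  dsimp only
  gcongr

theorem surplus_eq {Ω : Type*} (hw : 0 < w) (N Md : ℝ≥0 → Ω → ℕ) (t : ℝ≥0) (ω : Ω) :
    surplus u w b N Md t ω = w * ((N t ω : ℝ) * (b - w) / w + u / w - Md t ω) := by
  rw [surplus]
  push_cast
  field_simp
  ring

/-- Strict negativity asks for an integer strictly above the barrier, hence floor plus one even at
integer barriers; the weak inequality below leads to the ceiling instead. -/
theorem surplus_neg_iff {Ω : Type*} (hu : 0 < u) (hw : 0 < w) (hwb : w < b)
    (N Md : ℝ≥0 → Ω → ℕ) (t : ℝ≥0) (ω : Ω) : surplus u w b N Md t ω < 0 ↔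
      ⌊(N t ω : ℝ) * (b - w) / w + u / w⌋₊ + 1 ≤ Md t ω := by
  rw [surplus_eq hw, ← smul_eq_mul, smul_neg_iff_of_pos_left hw, sub_neg, Nat.add_one_le_iff,
    Nat.floor_lt (barrier_pos hu hw hwb _).le]

theorem surplus_nonpos_iff {Ω : Type*} (hw : 0 < w)
    (N Md : ℝ≥0 → Ω → ℕ) (t : ℝ≥0) (ω : Ω) : surplus u w b N Md t ω ≤ 0 ↔
      ⌈(N t ω : ℝ) * (b - w) / w + u / w⌉₊ ≤ Md t ω := by
  rw [surplus_eq hw, ← smul_eq_mul, smul_nonpos_iff_nonpos_of_pos_left hw, sub_nonpos, Nat.ceil_le]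

end Surplus

end PoolRuin

end

theorem theorem3p1 {Ω : Type*} [MeasurableSpace Ω] (P : Measure Ω) [IsProbabilityMeasure P]
    (N Md : ℝ≥0 → Ω → ℕ) (lam mud : ℝ≥0) (hlam : 0 < lam) (hmud : 0 < mud)
    (hN : PoolRuin.IsPoissonProcess N lam P) (hMd : PoolRuin.IsPoissonProcess Md mud P)
    (hindep : IndepFun (fun ω t => N t ω) (fun ω t => Md t ω) P)
    (u w b : ℝ) (hu : 0 < u) (hw : 0 < w) (hwb : w < b) :
    -- ruin time `inf {t ≥ 0 : R_t < 0}`; `v_n` is the least integer strictly above the barrier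
    PoolRuin.HasSeriesDensity P (PoolRuin.ruinTime (PoolRuin.surplus u w b N Md)) N Md
      (fun n => ⌊(n : ℝ) * (b - w) / w + u / w⌋₊ + 1) ∧
    -- the same time, `v_n` written with a ceiling, when no barrier is an integer
    ((∀ (n : ℕ) (k : ℤ), (n : ℝ) * (b - w) / w + u / w ≠ k) →
      PoolRuin.HasSeriesDensity P (PoolRuin.ruinTime (PoolRuin.surplus u w b N Md)) N Md
        (fun n => ⌈(n : ℝ) * (b - w) / w + u / w⌉₊)) ∧
    -- the first time the surplus reaches `0`, with the ceiling and no further condition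
    PoolRuin.HasSeriesDensity P (PoolRuin.exhaustionTime (PoolRuin.surplus u w b N Md)) N Md
      (fun n => ⌈(n : ℝ) * (b - w) / w + u / w⌉₊) := by
  have hpos := PoolRuin.barrier_pos hu hw hwb
  have hmono := PoolRuin.monotone_barrier (u := u) hw hwb
  have h1 : PoolRuin.HasSeriesDensity P (PoolRuin.ruinTime (PoolRuin.surplus u w b N Md)) N Md
      (fun n => ⌊(n : ℝ) * (b - w) / w + u / w⌋₊ + 1) := by
    have h := PoolRuin.hasSeriesDensity_hitting
      (v := fun n => ⌊(n : ℝ) * (b - w) / w + u / w⌋₊ + 1) hN hMd hlam hmud hindep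
      (fun m n hmn => Nat.succ_le_succ (Nat.floor_mono (hmono hmn))) (fun n => Nat.succ_pos _)
    simp only [← PoolRuin.surplus_neg_iff hu hw hwb] at h
    exact h
  refine ⟨h1, fun hne => ?_, ?_⟩
  -- Away from integers, ceiling and floor plus one coincide.
  · convert h1 using 2 with n
    refine (Nat.ceil_eq_iff (Nat.succ_ne_zero _)).2 ⟨?_, ?_⟩
    swap
    · exact_mod_cast (Nat.lt_floor_add_one _).le
    rw [Nat.succ_sub_one]
    exact (Nat.floor_le (hpos n).le).lt_of_ne fun h =>
      hne n (⌊(n : ℝ) * (b - w) / w + u / w⌋₊ : ℤ) (by rw [Int.cast_natCast, h])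
  · have h := PoolRuin.hasSeriesDensity_hitting
      (v := fun n => ⌈(n : ℝ) * (b - w) / w + u / w⌉₊) hN hMd hlam hmud hindep
      (fun m n hmn => Nat.ceil_mono (hmono hmn)) (fun n => Nat.ceil_pos.2 (hpos n))
    simp only [← PoolRuin.surplus_nonpos_iff hw] at h
    exact h
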